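/- Let $F$ be the CDF of an absolutely continuous probability distribution on $[0,\infty)$ and let $X_1,X_2,\dots$ be i.i.d. with CDF $F$. Let $L(x)=x/(1+x)$, $x\ge 0$ (and $L(x)=0$ for $x<0$), be the CDF of the log-logistic distribution LL(1). $F$ is said to be IOR (increasing odds rate) if its odds function $\Lambda_F=F/(1-F)$ is convex on $\{F<1\}$. For a sample of size $n\ge1$ from a distribution on $[0,\infty)$ with order statistics $X_{(1)}\le\dots\le X_{(n)}$, $X_{(0)}:=0$, and empirical CDF $\mathbb F_n$, let $T_n^{-1}:[0,1]\to\mathbb R$ be the linear interpolation of the values $$T_n^{-1}\left(\tfrac kn\right)=\int_0^{X_{(k)}}(1-\mathbb F_n(t))^2\,dt,\qquad k=0,\dots,n,$$ let $(T_n^{-1})_{cv}$ be its least concave majorant on $[0,1]$ and $\partial_+$ the right derivative. Put $$\widetilde\Lambda_n(x)=\int_0^x\frac{dt}{\partial_+(T_n^{-1})_{cv}(\mathbb F_n(t))}\quad(0\le x<X_{(n)}),$$ and let $\widetilde{\mathbb F}_n(x)=L(\widetilde\Lambda_n(x))$ for $0\le x<X_{(n)}$ and $\widetilde{\mathbb F}_n(x)=1$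 for $x\ge X_{(n)}$. Define $$\mathrm{KS}(\mathbb F_n)=\sup_{x>0}\left|\mathbb F_n(x)-\widetilde{\mathbb F}_n(x)\right|.$$ Fix $\alpha\in(0,1)$. For all sufficiently large $n$ let $c_{\alpha,n}$ be a critical value of level $\alpha$ calibrated under LL(1), that is, a real number with $$P(\mathrm{KS}(\mathbb L_n)>c_{\alpha,n})\le\alpha\le P(\mathrm{KS}(\mathbb L_n)\ge c_{\alpha,n}),$$ where $\mathbb L_n$ is the empirical CDF of a random sample of size $n$ from $L$ (in particular, any solution of $P(\mathrm{KS}(\mathbb L_n)\ge c_{\alpha,n})=\alpha$ is allowed). If $F$ is not IOR, then $$\lim_{n\to\infty}P\left(\mathrm{KS}(\mathbb F_n)>c_{\alpha,n}\right)=1.$$ -/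

import Mathlib

open MeasureTheory ProbabilityTheory Filter Topology Set

noncomputable section

namespace IOR

/-- The log-logistic CDF with shape parameter one: `L x = x / (1 + x)` for `x > 0`,
and `L x = 0` for `x ≤ 0`. -/
def L (x : ℝ) : ℝ := max x 0 / (1 + max x 0)

theorem L_eq (x : ℝ) : L x = 1 - (1 + max x 0)⁻¹ := by
  have : (1 + max x 0) ≠ 0 := by positivity
  unfold L
  field_simp
  ring

theorem L_mono : Monotone L := by
  intro x y hxy
  rw [L_eq, L_eq]
  gcongr

theorem L_continuous : Continuous L := by
  unfold L
  refine Continuous.div (by fun_prop) (by fun_prop) (fun x => ?_)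
  positivity

/-- `L` as a Stieltjes function. -/
def LStieltjes : StieltjesFunction ℝ where
  toFun := L
  mono' := L_mono
  right_continuous' _ := L_continuous.continuousWithinAt

/-- The LL(1) distribution: the law on `ℝ` whose CDF is `L`. -/
def LL1 : Measure ℝ := LStieltjes.measure

theorem L_tendsto_atBot : Tendsto L atBot (𝓝 0) := by
  refine tendsto_const_nhds.congr' ?_
  filter_upwards [eventually_le_atBot (0 : ℝ)] with x hx
  simp [L, max_eq_right hx]

theorem L_tendsto_atTop : Tendsto L atTop (𝓝 1) := by
  have h : Tendsto (fun x : ℝ => 1 - (1 + max x 0)⁻¹) atTop (𝓝 (1 - 0)) := by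
    refine tendsto_const_nhds.sub (tendsto_inv_atTop_zero.comp ?_)
    refine tendsto_atTop_mono (fun x => ?_) tendsto_id
    have := le_max_left x 0
    simp only [id]
    linarith
  rw [sub_zero] at h
  exact h.congr (fun x => (L_eq x).symm)

instance : IsProbabilityMeasure LL1 :=
  LStieltjes.isProbabilityMeasure L_tendsto_atBot L_tendsto_atTop

/-- The odds function `Λ_F = L⁻¹ ∘ F = F / (1 - F)`, meaningful where `F < 1`. -/
def odds (F : ℝ → ℝ) (x : ℝ) : ℝ := F x / (1 - F x)

/-- `F` has increasing odds rate: its odds function is convex. Beyond the right endpoint of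
the support (where `F = 1`) the odds are `+∞`, so that convexity is a condition on `{F < 1}`. -/
def IsIOR (F : ℝ → ℝ) : Prop := ConvexOn ℝ {x | F x < 1} (odds F)

/-- The least concave majorant, on the set `S`, of a function `g`: the pointwise infimum of all
functions that are concave on `S` and are at least `g` on `S`. -/
def leastConcaveMajorant (S : Set ℝ) (g : ℝ → ℝ) (p : ℝ) : ℝ :=
  sInf {y | ∃ h : ℝ → ℝ, ConcaveOn ℝ S h ∧ (∀ q ∈ S, g q ≤ h q) ∧ y = h p}

section Sample

variable {n : ℕ}

/-- The empirical CDF of the sample `x`. -/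
def ecdf (x : Fin n → ℝ) (t : ℝ) : ℝ :=
  (∑ i, if x i ≤ t then (1 : ℝ) else 0) / n

/-- The `k`-th order statistic `X_(k)` of the sample `x`, for `1 ≤ k ≤ n`, and `X_(0) = 0`.
(The value for `k > n` plays no role.) -/
def orderStat (x : Fin n → ℝ) (k : ℕ) : ℝ :=
  if h : 1 ≤ k ∧ k ≤ n then x (Tuple.sort x ⟨k - 1, by omega⟩) else 0

/-- The empirical transform at the node `k / n`: the integral of `(1 - 𝔽ₙ)²` from `0`
to `X_(k)`. -/
def TinvNode (x : Fin n → ℝ) (k : ℕ) : ℝ :=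
  ∫ t in (0 : ℝ)..(orderStat x k), (1 - ecdf x t) ^ 2

/-- The empirical transform `Tₙ⁻¹` on `[0, 1]`: the linear interpolation of its values at the
nodes `k / n`, `k = 0, …, n`. -/
def Tinv (x : Fin n → ℝ) (p : ℝ) : ℝ :=
  TinvNode x ⌊n * p⌋₊ +
    (n * p - ⌊n * p⌋₊) * (TinvNode x (⌊n * p⌋₊ + 1) - TinvNode x ⌊n * p⌋₊)

/-- The right derivative of the least concave majorant of `Tₙ⁻¹` on `[0, 1]`. -/
def lcmSlope (x : Fin n → ℝ) (p : ℝ) : ℝ :=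
  derivWithin (leastConcaveMajorant (Icc 0 1) (Tinv x)) (Ioi p) p

/-- The estimated odds rate, to be used on `(-∞, X_(n))`. (It is `+∞` from `X_(n)` on, which is
accounted for in `Ftilde`.) -/
def lambdaTilde (x : Fin n → ℝ) (t : ℝ) : ℝ :=
  if t ≤ 0 then 0 else 1 / lcmSlope x (ecdf x t)

/-- The estimated odds function, to be used on `(-∞, X_(n))`. -/
def LambdaTilde (x : Fin n → ℝ) (t : ℝ) : ℝ := ∫ s in (0 : ℝ)..t, lambdaTilde x s

/-- The increasing-odds-rate estimator of the CDF: `L ∘ LambdaTilde` to the left of `X_(n)`,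
where it has a jump to `1`. -/
def Ftilde (x : Fin n → ℝ) (t : ℝ) : ℝ :=
  if t < orderStat x n then L (LambdaTilde x t) else 1

/-- The Kolmogorov–Smirnov type statistic: the supremum over `t > 0` of `|𝔽ₙ - Ftilde|`. -/
def KS (x : Fin n → ℝ) : ℝ := ⨆ t : Ioi (0 : ℝ), |ecdf x t - Ftilde x t|

end Sample

/-- `c` is a critical value at level `α` for sample size `n`, calibrated under LL(1): for `n`
independent LL(1) observations, `P(KS > c) ≤ α ≤ P(KS ≥ c)`. Every solution of
`P(KS ≥ c) = α` is such a `c`. As the law of `KS` has atoms, that equation may have no solution,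
whereas a `c` as here always exists. -/
def IsCriticalValue (α : ℝ) (n : ℕ) (c : ℝ) : Prop :=
  Measure.pi (fun _ : Fin n => LL1) {y | c < KS y} ≤ ENNReal.ofReal α ∧
    ENNReal.ofReal α ≤ Measure.pi (fun _ : Fin n => LL1) {y | c ≤ KS y}

end IOR

end

/-!
The test is consistent because its critical values tend to zero, whereas the statistic stays away
from zero under every distribution without increasing odds rate.

*Alternatives.* For every sample of nonnegative numbers, with or without ties, the estimated odds
function `LambdaTilde` is convex to the left of `X_(n)`: it is the integral of `1 / slope`, where the
slope of the least concave majorant is positive at each value `𝔽ₙ(t)`, `0 < t < X_(n)`, and decreases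
(`lambdaTilde_monotoneOn`, `LambdaTilde_convexOn`). If convexity of the odds of `F` fails, it fails
at three points, by a positive margin. If `𝔽ₙ` is close to `F` at these points and `KS` is small,
then `LambdaTilde` is close to the odds of `F` at these points, which contradicts its convexity
(`exists_le_KS_of_not_isIOR`). By Chebyshev's inequality, `𝔽ₙ` is close to `F` at finitely many points
with probability tending to one (`tendsto_measure_ecdf_far`).

*Critical values.* Under LL(1) the transform `∫ (1 - L) ^ 2` over `[0, t]` is `L t`, so its empirical
version `Tinv` should be close to the identity of `[0, 1]`. Then so is its least concave majorant,
whose slopes, by concavity, are close to `1` away from the endpoints of `[0, 1]`. Hence `LambdaTilde t`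
is close to `t` in the relative sense that matters, and `KS` is small (`KS_le_of_close`). That `Tinv`
is close to the identity up to the right endpoint `1` needs control of the tail, as `LL(1)` has
infinite mean: the sample lies in `[0, n ^ 2]` with high probability, and by Tonelli's theorem the
expectation of the integral of `(𝔽ₙ - L) ^ 2` over this interval is at most `log (1 + n ^ 2) / n`.
Together with the integrability of `(1 - L) ^ 2` this bounds the integral of
`|(1 - 𝔽ₙ) ^ 2 - (1 - L) ^ 2|` over the whole interval (`abs_integral_sub_L_le`). So `KS` tends to zero
in probability under LL(1) (`tendsto_measure_le_KS`), and since the level `α` is positive, the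
critical values are eventually below any given positive number (`eventually_lt_of_isCriticalValue`).
-/

namespace IOR

/-! ### The empirical distribution function and the order statistics -/

section Deterministic

variable {n : ℕ} {x : Fin n → ℝ}

lemma ecdf_eq_card (x : Fin n → ℝ) (t : ℝ) :
    ecdf x t = (Finset.card {i | x i ≤ t} : ℝ) / n := by
  simp [ecdf]

lemma ecdf_mono (x : Fin n → ℝ) : Monotone (ecdf x) := by
  intro s t hst
  simp only [ecdf_eq_card]
  gcongr

lemma ecdf_nonneg (x : Fin n → ℝ) (t : ℝ) : 0 ≤ ecdf x t := by
  rw [ecdf_eq_card]; positivity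

lemma card_le_sample_size (x : Fin n → ℝ) (t : ℝ) : Finset.card {i | x i ≤ t} ≤ n := by
  simpa using Finset.card_le_univ ({i | x i ≤ t} : Finset (Fin n))

lemma ecdf_le_one (x : Fin n → ℝ) (t : ℝ) : ecdf x t ≤ 1 := by
  rw [ecdf_eq_card]
  exact div_le_one_of_le₀ (by exact_mod_cast card_le_sample_size x t) (by positivity)

/-- The Galois connection between the order statistics and the counting function of the
sample. -/
lemma orderStat_le_iff {k : ℕ} (hk : 1 ≤ k) (hkn : k ≤ n) (t : ℝ) :
    orderStat x k ≤ t ↔ k ≤ Finset.card {i | x i ≤ t} := by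
  have h := Tuple.lt_card_le_iff_apply_le_of_monotone (j := (⟨k - 1, by omega⟩ : Fin n)) (a := t)
    (Tuple.monotone_sort x)
  have hcard : Finset.card {i | (x ∘ Tuple.sort x) i ≤ t} = Finset.card {i | x i ≤ t} :=
    Finset.card_equiv (Tuple.sort x) (by simp)
  rw [hcard] at h
  rw [orderStat, dif_pos ⟨hk, hkn⟩]
  refine Iff.trans h.symm ?_
  simp only
  omega

lemma orderStat_nonneg (hx : ∀ i, 0 ≤ x i) (k : ℕ) : 0 ≤ orderStat x k := by
  unfold orderStat
  split_ifs
  · exact hx _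
  · exact le_rfl

lemma orderStat_mono (hx : ∀ i, 0 ≤ x i) {j k : ℕ} (hjk : j ≤ k) (hk : k ≤ n) :
    orderStat x j ≤ orderStat x k := by
  rcases Nat.eq_zero_or_pos j with rfl | hj
  · simpa [orderStat] using orderStat_nonneg hx k
  · rw [orderStat_le_iff hj (hjk.trans hk)]
    exact hjk.trans ((orderStat_le_iff (hj.trans_le hjk) hk _).1 le_rfl)

lemma lt_orderStat_iff_ecdf_lt_one (hn : 1 ≤ n) (t : ℝ) :
    t < orderStat x n ↔ ecdf x t < 1 := by
  have hn' : (0 : ℝ) < n := by exact_mod_cast hn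
  rw [← not_le, orderStat_le_iff hn le_rfl, ecdf_eq_card, div_lt_one hn', not_le, Nat.cast_lt]

lemma intervalIntegrable_one_sub_ecdf_sq (x : Fin n → ℝ) (a b : ℝ) :
    IntervalIntegrable (fun t => (1 - ecdf x t) ^ 2) volume a b := by
  refine Antitone.intervalIntegrable fun s t hst => ?_
  have := ecdf_mono x hst
  have := ecdf_le_one x t
  gcongr

/-! ### The empirical transform -/

lemma TinvNode_sub (x : Fin n → ℝ) (j k : ℕ) :
    TinvNode x k - TinvNode x j =
      ∫ t in (orderStat x j)..(orderStat x k), (1 - ecdf x t) ^ 2 :=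
  intervalIntegral.integral_interval_sub_left (intervalIntegrable_one_sub_ecdf_sq x _ _)
    (intervalIntegrable_one_sub_ecdf_sq x _ _)

lemma TinvNode_mono (hx : ∀ i, 0 ≤ x i) {j k : ℕ} (hjk : j ≤ k) (hk : k ≤ n) :
    TinvNode x j ≤ TinvNode x k := by
  rw [← sub_nonneg, TinvNode_sub]
  exact intervalIntegral.integral_nonneg (orderStat_mono hx hjk hk) fun _ _ => sq_nonneg _

/-- Between the two order statistics that enclose a point `0 ≤ t < X_(n)` the empirical transform
increases strictly, whether or not the sample has ties. -/
lemma TinvNode_lt_succ (hn : 1 ≤ n) {t : ℝ} (ht : 0 ≤ t)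
    (htn : t < orderStat x n) :
    TinvNode x (Finset.card {i | x i ≤ t}) < TinvNode x (Finset.card {i | x i ≤ t} + 1) := by
  set k := Finset.card {i | x i ≤ t} with hk
  have hkn : k < n := by
    rw [lt_orderStat_iff_ecdf_lt_one hn, ecdf_eq_card, div_lt_one (by exact_mod_cast hn)] at htn
    exact_mod_cast htn
  have h1 : orderStat x k ≤ t := by
    rcases Nat.eq_zero_or_pos k with h0 | h0
    · rw [h0]; simpa [orderStat] using ht
    · rw [orderStat_le_iff h0 hkn.le]
  have h2 : t < orderStat x (k + 1) := by
    rw [← not_le, orderStat_le_iff (by omega) (by omega)]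
    omega
  rw [← sub_pos, TinvNode_sub]
  refine intervalIntegral.intervalIntegral_pos_of_pos_on
    (intervalIntegrable_one_sub_ecdf_sq x _ _) (fun s hs => ?_) (h1.trans_lt h2)
  have h3 : s < orderStat x n := by
    refine lt_of_not_ge fun h => ?_
    have h4 := (orderStat_le_iff hn le_rfl s).1 h
    have h5 := (orderStat_le_iff (x := x) (k := k + 1) (by omega) (by omega) s).2 (by omega)
    exact absurd hs.2 (not_lt.2 h5)
  rw [lt_orderStat_iff_ecdf_lt_one hn] at h3
  have : 0 < 1 - ecdf x s := by linarith
  positivity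

lemma floor_mul_add_one_le (hn : 1 ≤ n) {p : ℝ} (hp : p ∈ Ico (0 : ℝ) 1) :
    ⌊n * p⌋₊ + 1 ≤ n := by
  have hn' : (0 : ℝ) < n := by exact_mod_cast hn
  have : ⌊n * p⌋₊ < n := by
    rw [Nat.floor_lt (by have := hp.1; positivity)]
    nlinarith [hp.2]
  omega

lemma Tinv_one (x : Fin n → ℝ) : Tinv x 1 = TinvNode x n := by
  simp [Tinv]

/-- On `[0, 1)` the value `Tinv x p` is a convex combination of two neighbouring nodes, with the
weights for which the same combination of the abscissae is `p`. -/
lemma exists_Tinv_eq (hn : 1 ≤ n) {p : ℝ} (hp : p ∈ Ico (0 : ℝ) 1) :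
    ∃ k : ℕ, ∃ w ∈ Ico (0 : ℝ) 1, k + 1 ≤ n ∧ n * p = k + w ∧
      Tinv x p = (1 - w) * TinvNode x k + w * TinvNode x (k + 1) := by
  refine ⟨⌊n * p⌋₊, n * p - ⌊n * p⌋₊, ⟨?_, ?_⟩, floor_mul_add_one_le hn hp, by ring, by rw [Tinv]; ring⟩
  · have := Nat.floor_le (a := (n : ℝ) * p) (by have := hp.1; positivity)
    linarith
  · have := Nat.lt_floor_add_one ((n : ℝ) * p)
    linarith

lemma Tinv_le_last (hn : 1 ≤ n) (hx : ∀ i, 0 ≤ x i) {p : ℝ} (hp : p ∈ Icc (0 : ℝ) 1) :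
    Tinv x p ≤ TinvNode x n := by
  rcases eq_or_lt_of_le hp.2 with rfl | h1
  · exact (Tinv_one x).le
  · obtain ⟨k, w, hw, hk, -, hT⟩ := exists_Tinv_eq (x := x) hn ⟨hp.1, h1⟩
    have h2 := TinvNode_mono hx (Nat.le_of_succ_le hk) le_rfl
    have h3 := TinvNode_mono hx hk le_rfl
    rw [hT]
    nlinarith [hw.1, hw.2]

/-- Linear interpolation reproduces affine functions, so that closeness of the empirical
transform to the identity at the nodes carries over to `[0, 1]`. -/
lemma abs_Tinv_sub_le (hn : 1 ≤ n) {e : ℝ} (he : ∀ k ≤ n, |TinvNode x k - k / n| ≤ e)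
    {p : ℝ} (hp : p ∈ Icc (0 : ℝ) 1) : |Tinv x p - p| ≤ e := by
  have hn' : (0 : ℝ) < n := by exact_mod_cast hn
  rcases eq_or_lt_of_le hp.2 with rfl | h1
  · simpa [Tinv_one, hn'.ne'] using he n le_rfl
  · obtain ⟨k, w, hw, hk, hkw, hT⟩ := exists_Tinv_eq (x := x) hn ⟨hp.1, h1⟩
    have h2 := abs_le.1 (he k (by omega))
    have h3 := abs_le.1 (he (k + 1) hk)
    have h4 : p = (1 - w) * (k / n) + w * ((k + 1 : ℕ) / n) := by
      field_simp
      push_cast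
      linarith
    have hw1 : 0 ≤ 1 - w := by linarith [hw.2]
    have hw0 := hw.1
    rw [hT, abs_le]
    constructor <;> nlinarith

/-! ### The least concave majorant and its slopes -/

section Majorant

variable {S : Set ℝ} {g h : ℝ → ℝ} {p : ℝ}

lemma bddBelow_majorants (g : ℝ → ℝ) (hp : p ∈ S) :
    BddBelow {y | ∃ h : ℝ → ℝ, ConcaveOn ℝ S h ∧ (∀ q ∈ S, g q ≤ h q) ∧ y = h p} := by
  refine ⟨g p, ?_⟩
  rintro y ⟨h, -, hh, rfl⟩
  exact hh p hp

lemma leastConcaveMajorant_le (hh : ConcaveOn ℝ S h) (hgh : ∀ q ∈ S, g q ≤ h q) (hp : p ∈ S) :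
    leastConcaveMajorant S g p ≤ h p :=
  csInf_le (bddBelow_majorants g hp) ⟨h, hh, hgh, rfl⟩

lemma le_leastConcaveMajorant (hh : ConcaveOn ℝ S h) (hgh : ∀ q ∈ S, g q ≤ h q) (hp : p ∈ S) :
    g p ≤ leastConcaveMajorant S g p := by
  refine le_csInf ⟨_, h, hh, hgh, rfl⟩ ?_
  rintro y ⟨k, -, hk, rfl⟩
  exact hk p hp

lemma concaveOn_leastConcaveMajorant (hh : ConcaveOn ℝ S h) (hgh : ∀ q ∈ S, g q ≤ h q) :
    ConcaveOn ℝ S (leastConcaveMajorant S g) := by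
  refine ⟨hh.1, fun p hp q hq a b ha hb hab => ?_⟩
  refine le_csInf ⟨_, h, hh, hgh, rfl⟩ ?_
  rintro y ⟨k, hk, hgk, rfl⟩
  refine le_trans ?_ (hk.2 hp hq ha hb hab)
  have h1 := leastConcaveMajorant_le hk hgk hp
  have h2 := leastConcaveMajorant_le hk hgk hq
  gcongr

/-- At an interior point the right derivative of a concave function is at most the slope of any
secant line to the left. -/
lemma rightDeriv_le_slope_left {f : ℝ → ℝ} (hf : ConcaveOn ℝ S f) {r q : ℝ} (hr : r ∈ S)
    (hq : q ∈ interior S) (hrq : r < q) :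
    derivWithin f (Ioi q) q ≤ (f q - f r) / (q - r) := by
  have hd : DifferentiableWithinAt ℝ f (Ioi q) q := by
    simpa using (hf.neg.differentiableWithinAt_Ioi_of_mem_interior hq).neg
  have ht : Tendsto (slope f q) (𝓝[>] q) (𝓝 (derivWithin f (Ioi q) q)) :=
    (hasDerivWithinAt_iff_tendsto_slope' self_notMem_Ioi).1 hd.hasDerivWithinAt
  refine le_of_tendsto ht ?_
  have hS : S ∈ 𝓝[>] q := mem_nhdsWithin_of_mem_nhds (mem_interior_iff_mem_nhds.1 hq)
  filter_upwards [hS, self_mem_nhdsWithin] with y hy hqy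
  rw [slope_def_field]
  exact hf.slope_anti_adjacent hr hy hrq hqy

end Majorant

lemma concaveOn_lcm_Tinv (hn : 1 ≤ n) (hx : ∀ i, 0 ≤ x i) :
    ConcaveOn ℝ (Icc 0 1) (leastConcaveMajorant (Icc 0 1) (Tinv x)) :=
  concaveOn_leastConcaveMajorant (concaveOn_const (TinvNode x n) (convex_Icc 0 1))
    fun _ hq => Tinv_le_last hn hx hq

lemma lcm_Tinv_le_last (hn : 1 ≤ n) (hx : ∀ i, 0 ≤ x i) {p : ℝ} (hp : p ∈ Icc (0 : ℝ) 1) :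
    leastConcaveMajorant (Icc 0 1) (Tinv x) p ≤ TinvNode x n :=
  leastConcaveMajorant_le (concaveOn_const (TinvNode x n) (convex_Icc 0 1))
    (fun _ hq => Tinv_le_last hn hx hq) hp

lemma Tinv_le_lcm (hn : 1 ≤ n) (hx : ∀ i, 0 ≤ x i) {p : ℝ} (hp : p ∈ Icc (0 : ℝ) 1) :
    Tinv x p ≤ leastConcaveMajorant (Icc 0 1) (Tinv x) p :=
  le_leastConcaveMajorant (concaveOn_const (TinvNode x n) (convex_Icc 0 1))
    (fun _ hq => Tinv_le_last hn hx hq) hp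

lemma lcm_Tinv_one (hn : 1 ≤ n) (hx : ∀ i, 0 ≤ x i) :
    leastConcaveMajorant (Icc 0 1) (Tinv x) 1 = TinvNode x n :=
  le_antisymm (lcm_Tinv_le_last hn hx (by simp))
    ((Tinv_one x).symm.le.trans (Tinv_le_lcm hn hx (by simp)))

/-- The least concave majorant has not yet reached its maximum at `𝔽ₙ(t)`, for `0 ≤ t < X_(n)`. -/
lemma lcm_Tinv_ecdf_lt_last (hn : 1 ≤ n) (hx : ∀ i, 0 ≤ x i) {t : ℝ} (ht : 0 ≤ t)
    (htn : t < orderStat x n) :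
    leastConcaveMajorant (Icc 0 1) (Tinv x) (ecdf x t) < TinvNode x n := by
  have hn' : (1 : ℝ) ≤ n := by exact_mod_cast hn
  have hlt := TinvNode_lt_succ hn ht htn
  have hp1 := (lt_orderStat_iff_ecdf_lt_one hn t).1 htn
  have hp0 := ecdf_nonneg x t
  rw [ecdf_eq_card] at *
  set k := Finset.card {i | x i ≤ t} with hk
  have hkn : k + 1 ≤ n := by
    rw [div_lt_one (by linarith)] at hp1
    exact_mod_cast hp1
  set s := TinvNode x (k + 1) - TinvNode x k with hs
  have hs0 : 0 < s := sub_pos.2 hlt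
  have hlast := TinvNode_mono hx hkn le_rfl
  -- The concave majorant `q ↦ min M (M - s * ((k + 1) / n - q))`, with `M` the last node, is
  -- smaller than `M` at `k / n`.
  set h : ℝ → ℝ := fun q => min (TinvNode x n) (TinvNode x n + -(s * ((k + 1) / n)) + s * q)
    with hh
  have hconc : ConcaveOn ℝ (Icc 0 1) h := by
    refine (concaveOn_const _ (convex_Icc 0 1)).inf ?_
    exact (concaveOn_const _ (convex_Icc 0 1)).add
      ((concaveOn_id (convex_Icc 0 1)).smul hs0.le)
  have hmaj : ∀ q ∈ Icc (0 : ℝ) 1, Tinv x q ≤ h q := by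
    intro q hq
    refine le_min (Tinv_le_last hn hx hq) ?_
    have hk1 : ((k : ℝ) + 1) / n ≤ 1 :=
      div_le_one_of_le₀ (by exact_mod_cast hkn) (by linarith)
    rcases le_or_gt (((k : ℝ) + 1) / n) q with hq1 | hq1
    · have := Tinv_le_last hn hx hq
      nlinarith
    obtain ⟨j, w, hw, hj, hjw, hT⟩ := exists_Tinv_eq (x := x) hn ⟨hq.1, hq1.trans_le hk1⟩
    have hw0 := hw.1
    have hw1 := hw.2
    have hjk : j < k + 1 := by
      rw [lt_div_iff₀ (by linarith)] at hq1
      have : (j : ℝ) < k + 1 := by nlinarith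
      exact_mod_cast this
    rcases Nat.lt_succ_iff_lt_or_eq.1 hjk with hjk | rfl
    · have h1 : TinvNode x j ≤ TinvNode x k := TinvNode_mono hx hjk.le (by omega)
      have h2 : TinvNode x (j + 1) ≤ TinvNode x k := TinvNode_mono hx hjk (by omega)
      have h3 : Tinv x q ≤ TinvNode x k := by rw [hT]; nlinarith
      have h4 : s * (((k : ℝ) + 1) / n) ≤ s := mul_le_of_le_one_right hs0.le hk1
      have h5 : 0 ≤ s * q := mul_nonneg hs0.le hq.1
      linarith
    · have h1 : ((k : ℝ) + 1) / n - q ≤ 1 - w := by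
        have : ((k : ℝ) + 1) / n - q = (1 - w) / n := by
          field_simp
          linarith
        rw [this]
        exact div_le_self (by linarith) hn'
      have h2 : Tinv x q = TinvNode x (k + 1) - (1 - w) * s := by rw [hT, hs]; ring
      have h3 : s * (((k : ℝ) + 1) / n - q) ≤ s * (1 - w) := by gcongr
      linarith
  refine (leastConcaveMajorant_le hconc hmaj ⟨hp0, hp1.le⟩).trans_lt
    ((min_le_right _ _).trans_lt ?_)
  have : s * ((k + 1) / n) - s * (k / n) = s / n := by ring
  have : 0 < s / n := by positivity
  linarith

lemma lcmSlope_nonneg (hn : 1 ≤ n) (hx : ∀ i, 0 ≤ x i) {p : ℝ} (hp : p ∈ Ico (0 : ℝ) 1) :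
    0 ≤ lcmSlope x p := by
  by_cases hd : DifferentiableWithinAt ℝ (leastConcaveMajorant (Icc 0 1) (Tinv x)) (Ioi p) p
  · refine le_trans ?_ ((concaveOn_lcm_Tinv hn hx).slope_le_rightDeriv ⟨hp.1, hp.2.le⟩
      (by simp) hp.2 hd)
    rw [slope_def_field, lcm_Tinv_one hn hx]
    exact div_nonneg (sub_nonneg.2 (lcm_Tinv_le_last hn hx ⟨hp.1, hp.2.le⟩)) (by linarith [hp.2])
  · rw [lcmSlope, derivWithin_zero_of_not_differentiableWithinAt hd]

lemma differentiableWithinAt_lcm_Tinv (hn : 1 ≤ n) (hx : ∀ i, 0 ≤ x i) {p : ℝ}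
    (hp : p ∈ Ioo (0 : ℝ) 1) :
    DifferentiableWithinAt ℝ (leastConcaveMajorant (Icc 0 1) (Tinv x)) (Ioi p) p := by
  have := (concaveOn_lcm_Tinv hn hx).neg.differentiableWithinAt_Ioi_of_mem_interior
    (by rwa [interior_Icc])
  simpa using this.neg

lemma lcmSlope_ecdf_pos (hn : 1 ≤ n) (hx : ∀ i, 0 ≤ x i) {t : ℝ} (ht : 0 ≤ t)
    (htn : t < orderStat x n) (hp : 0 < ecdf x t) : 0 < lcmSlope x (ecdf x t) := by
  have hp1 := (lt_orderStat_iff_ecdf_lt_one hn t).1 htn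
  refine lt_of_lt_of_le ?_ ((concaveOn_lcm_Tinv hn hx).slope_le_rightDeriv ⟨hp.le, hp1.le⟩
      (by simp) hp1 (differentiableWithinAt_lcm_Tinv hn hx ⟨hp, hp1⟩))
  rw [slope_def_field, lcm_Tinv_one hn hx]
  exact div_pos (sub_pos.2 (lcm_Tinv_ecdf_lt_last hn hx ht htn)) (by linarith)

/-! ### The estimated odds rate and odds function -/

lemma lambdaTilde_nonneg (hn : 1 ≤ n) (hx : ∀ i, 0 ≤ x i) {t : ℝ} (htn : t < orderStat x n) :
    0 ≤ lambdaTilde x t := by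
  unfold lambdaTilde
  split_ifs
  · exact le_rfl
  · exact one_div_nonneg.2 (lcmSlope_nonneg hn hx
      ⟨ecdf_nonneg x t, (lt_orderStat_iff_ecdf_lt_one hn t).1 htn⟩)

lemma lambdaTilde_monotoneOn (hn : 1 ≤ n) (hx : ∀ i, 0 ≤ x i) :
    MonotoneOn (lambdaTilde x) (Iio (orderStat x n)) := by
  intro s hs t ht hst
  have hnn := lambdaTilde_nonneg hn hx ht
  rcases le_or_gt s 0 with hs0 | hs0
  · rwa [show lambdaTilde x s = 0 by rw [lambdaTilde, if_pos hs0]]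
  have ht0 := hs0.trans_le hst
  have hp0 := ecdf_nonneg x s
  have hp1 := (lt_orderStat_iff_ecdf_lt_one hn s).1 hs
  have hq1 := (lt_orderStat_iff_ecdf_lt_one hn t).1 ht
  have hlt : lambdaTilde x t = 1 / lcmSlope x (ecdf x t) := if_neg ht0.not_ge
  have hls : lambdaTilde x s = 1 / lcmSlope x (ecdf x s) := if_neg hs0.not_ge
  rw [hlt] at hnn ⊢
  rw [hls]
  rcases eq_or_lt_of_le (ecdf_mono x hst) with hpq | hpq
  · rw [hpq]
  have hq0 := hp0.trans_lt hpq
  by_cases hd : DifferentiableWithinAt ℝ (leastConcaveMajorant (Icc 0 1) (Tinv x))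
    (Ioi (ecdf x s)) (ecdf x s)
  · refine one_div_le_one_div_of_le (lcmSlope_ecdf_pos hn hx ht0.le ht hq0) ?_
    have hconc := concaveOn_lcm_Tinv hn hx
    refine (rightDeriv_le_slope_left hconc ⟨hp0, hp1.le⟩ (by rw [interior_Icc]; exact ⟨hq0, hq1⟩)
      hpq).trans ?_
    rw [← slope_def_field]
    exact hconc.slope_le_rightDeriv ⟨hp0, hp1.le⟩ ⟨hq0.le, hq1.le⟩ hpq hd
  -- Without a right derivative (at the left endpoint), `lcmSlope` and its inverse are `0`.
  · rwa [show lcmSlope x (ecdf x s) = 0 from derivWithin_zero_of_not_differentiableWithinAt hd,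
      div_zero]

lemma lambdaTilde_intervalIntegrable (hn : 1 ≤ n) (hx : ∀ i, 0 ≤ x i) {s t : ℝ}
    (hs : s < orderStat x n) (ht : t < orderStat x n) :
    IntervalIntegrable (lambdaTilde x) volume s t :=
  ((lambdaTilde_monotoneOn hn hx).mono fun _ hu =>
    (show _ < _ from hu.2.trans_lt (max_lt hs ht))).intervalIntegrable

lemma LambdaTilde_sub (hn : 1 ≤ n) (hx : ∀ i, 0 ≤ x i) {s t : ℝ} (h0 : 0 < orderStat x n)
    (hs : s < orderStat x n) (ht : t < orderStat x n) :
    LambdaTilde x t - LambdaTilde x s = ∫ u in s..t, lambdaTilde x u :=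
  intervalIntegral.integral_interval_sub_left (lambdaTilde_intervalIntegrable hn hx h0 ht)
    (lambdaTilde_intervalIntegrable hn hx h0 hs)

lemma LambdaTilde_of_nonpos {t : ℝ} (ht : t ≤ 0) : LambdaTilde x t = 0 := by
  rw [LambdaTilde, intervalIntegral.integral_symm, neg_eq_zero]
  refine intervalIntegral.integral_zero_ae (Eventually.of_forall fun s hs => ?_)
  rw [uIoc_of_le ht] at hs
  rw [lambdaTilde, if_pos hs.2]

lemma LambdaTilde_monotoneOn (hn : 1 ≤ n) (hx : ∀ i, 0 ≤ x i) (h0 : 0 < orderStat x n) :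
    MonotoneOn (LambdaTilde x) (Iio (orderStat x n)) := by
  intro s hs t ht hst
  rw [← sub_nonneg, LambdaTilde_sub hn hx h0 hs ht]
  exact intervalIntegral.integral_nonneg hst fun u hu =>
    lambdaTilde_nonneg hn hx (hu.2.trans_lt ht)

lemma LambdaTilde_nonneg (hn : 1 ≤ n) (hx : ∀ i, 0 ≤ x i) (h0 : 0 < orderStat x n) {t : ℝ}
    (ht : t < orderStat x n) : 0 ≤ LambdaTilde x t := by
  rcases le_total t 0 with h | h
  · exact (LambdaTilde_of_nonpos h).ge
  · exact (LambdaTilde_of_nonpos le_rfl).symm.le.trans (LambdaTilde_monotoneOn hn hx h0 h0 ht h)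

/-- The estimator is indeed a distribution with increasing odds rate. -/
lemma LambdaTilde_convexOn (hn : 1 ≤ n) (hx : ∀ i, 0 ≤ x i) (h0 : 0 < orderStat x n) :
    ConvexOn ℝ (Iio (orderStat x n)) (LambdaTilde x) := by
  refine convexOn_of_slope_mono_adjacent (convex_Iio _) fun {r s t} hr ht hrs hst => ?_
  have hs : s < orderStat x n := hst.trans ht
  have hmono := lambdaTilde_monotoneOn hn hx
  rw [LambdaTilde_sub hn hx h0 hr hs, LambdaTilde_sub hn hx h0 hs ht]
  trans lambdaTilde x s
  · rw [div_le_iff₀ (sub_pos.2 hrs)]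
    refine (intervalIntegral.integral_mono_on hrs.le (lambdaTilde_intervalIntegrable hn hx hr hs)
      intervalIntegrable_const fun u hu => hmono (hu.2.trans_lt hs) hs hu.2).trans_eq ?_
    rw [intervalIntegral.integral_const, smul_eq_mul, mul_comm]
  · rw [le_div_iff₀ (sub_pos.2 hst)]
    refine Eq.trans_le ?_ (intervalIntegral.integral_mono_on hst.le intervalIntegrable_const
      (lambdaTilde_intervalIntegrable hn hx hs ht) fun u hu => hmono hs (hu.2.trans_lt ht) hu.1)
    rw [intervalIntegral.integral_const, smul_eq_mul, mul_comm]

/-! ### The goodness-of-fit statistic -/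

lemma L_nonneg (t : ℝ) : 0 ≤ L t := by
  unfold L; positivity

lemma L_lt_one (t : ℝ) : L t < 1 := by
  rw [L_eq]
  have : 0 < (1 + max t 0)⁻¹ := by positivity
  linarith

lemma Ftilde_mem_Icc (x : Fin n → ℝ) (t : ℝ) : Ftilde x t ∈ Icc (0 : ℝ) 1 := by
  unfold Ftilde
  split_ifs
  · exact ⟨L_nonneg _, (L_lt_one _).le⟩
  · simp

lemma le_KS (x : Fin n → ℝ) {t : ℝ} (ht : 0 < t) : |ecdf x t - Ftilde x t| ≤ KS x := by
  refine le_ciSup (f := fun t : Ioi (0 : ℝ) => |ecdf x t - Ftilde x t|) ⟨1, ?_⟩ ⟨t, ht⟩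
  rintro _ ⟨s, rfl⟩
  have h1 := Ftilde_mem_Icc x s
  have h2 := ecdf_nonneg x s
  have h3 := ecdf_le_one x s
  exact abs_le.2 ⟨by linarith [h1.2], by linarith [h1.1]⟩

lemma KS_le {e : ℝ} (h : ∀ t, 0 < t → |ecdf x t - Ftilde x t| ≤ e) : KS x ≤ e :=
  haveI : Nonempty (Ioi (0 : ℝ)) := ⟨⟨1, mem_Ioi.2 one_pos⟩⟩
  ciSup_le fun t => h t t.2

end Deterministic

/-! ### Alternatives: the statistic stays away from zero -/

lemma odds_L {v : ℝ} (hv : 0 ≤ v) : L v / (1 - L v) = v := by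
  have : 1 + v ≠ 0 := by positivity
  rw [L, max_eq_left hv]
  field_simp
  ring_nf

/-- If the odds of a distribution function `F` on the half-line are not convex, then convexity fails
at three points with some margin. A sample whose empirical distribution function is close to `F`
at these points therefore has a large value of `KS`: were it small, the convex function
`LambdaTilde` would be close to the odds of `F` at the three points. -/
lemma exists_le_KS_of_not_isIOR {F : ℝ → ℝ} (hmono : Monotone F) (h0 : ∀ t ≤ 0, F t = 0)
    (hF : ¬ IsIOR F) :
    ∃ δ > 0, ∃ T : Finset ℝ, ∀ n : ℕ, 1 ≤ n → ∀ x : Fin n → ℝ, (∀ i, 0 ≤ x i) →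
      (∀ u ∈ T, |ecdf x u - F u| < δ) → δ ≤ KS x := by
  have hconv : Convex ℝ {x | F x < 1} :=
    OrdConnected.convex ⟨fun a _ b hb c hc => (hmono hc.2).trans_lt hb⟩
  simp only [IsIOR, ConvexOn, hconv, true_and, not_forall, not_le, smul_eq_mul] at hF
  obtain ⟨u, hu, v, hv, a, b, ha, hb, hab, hlt⟩ := hF
  set z := a * u + b * v with hz
  have hz1 : F z < 1 := hconv hu hv ha hb hab
  let U : Set (ℝ × ℝ × ℝ) := {w | a * (w.1 / (1 - w.1)) + b * (w.2.1 / (1 - w.2.1)) <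
    w.2.2 / (1 - w.2.2) ∧ w.1 < 1 ∧ w.2.1 < 1 ∧ w.2.2 < 1}
  have hU : U ∈ 𝓝 (F u, F v, F z) := by
    have e1 : ∀ᶠ w : ℝ × ℝ × ℝ in 𝓝 (F u, F v, F z), w.1 < 1 :=
      continuousAt_fst.eventually_lt continuousAt_const hu
    have e2 : ∀ᶠ w : ℝ × ℝ × ℝ in 𝓝 (F u, F v, F z), w.2.1 < 1 :=
      (continuous_fst.comp continuous_snd).continuousAt.eventually_lt continuousAt_const hv
    have e3 : ∀ᶠ w : ℝ × ℝ × ℝ in 𝓝 (F u, F v, F z), w.2.2 < 1 :=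
      (continuous_snd.comp continuous_snd).continuousAt.eventually_lt continuousAt_const hz1
    have hu' : 1 - F u ≠ 0 := (sub_pos.2 hu).ne'
    have hv' : 1 - F v ≠ 0 := (sub_pos.2 hv).ne'
    have hz' : 1 - F z ≠ 0 := (sub_pos.2 hz1).ne'
    have e4 : ∀ᶠ w : ℝ × ℝ × ℝ in 𝓝 (F u, F v, F z),
        a * (w.1 / (1 - w.1)) + b * (w.2.1 / (1 - w.2.1)) < w.2.2 / (1 - w.2.2) := by
      have c1 : ContinuousAt (fun w : ℝ × ℝ × ℝ => w.1 / (1 - w.1)) (F u, F v, F z) :=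
        ContinuousAt.div (by fun_prop) (by fun_prop) hu'
      have c2 : ContinuousAt (fun w : ℝ × ℝ × ℝ => w.2.1 / (1 - w.2.1)) (F u, F v, F z) :=
        ContinuousAt.div (by fun_prop) (by fun_prop) hv'
      have c3 : ContinuousAt (fun w : ℝ × ℝ × ℝ => w.2.2 / (1 - w.2.2)) (F u, F v, F z) :=
        ContinuousAt.div (by fun_prop) (by fun_prop) hz'
      exact ((continuousAt_const.mul c1).add (continuousAt_const.mul c2)).eventually_lt c3 hlt
    filter_upwards [e1, e2, e3, e4] with w h1 h2 h3 h4 using ⟨h4, h1, h2, h3⟩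
  obtain ⟨e, he, hball⟩ := Metric.mem_nhds_iff.1 hU
  have key : ∀ w1 w2 w3 : ℝ, |w1 - F u| < e → |w2 - F v| < e → |w3 - F z| < e →
      (w1, w2, w3) ∈ U := fun w1 w2 w3 h1 h2 h3 => hball (by
    simp only [Metric.mem_ball, Prod.dist_eq, Real.dist_eq]
    exact max_lt h1 (max_lt h2 h3))
  refine ⟨min (e / 2) 1, by positivity, {0, u, v, z}, fun n hn x hx hT => ?_⟩
  by_contra! hKS
  have hd : min (e / 2) 1 ≤ e / 2 := min_le_left _ _
  have hpos : 0 < orderStat x n := by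
    rw [lt_orderStat_iff_ecdf_lt_one hn]
    have := hT 0 (by simp)
    rw [h0 0 le_rfl, sub_zero] at this
    exact (le_abs_self _).trans_lt (this.trans_le (min_le_right _ _))
  have hTu := hT u (by simp)
  have hTv := hT v (by simp)
  have hTz := hT z (by simp)
  obtain ⟨-, hu1, hv1, hz1⟩ := key (ecdf x u) (ecdf x v) (ecdf x z) (by linarith) (by linarith)
    (by linarith)
  rw [← lt_orderStat_iff_ecdf_lt_one hn] at hu1 hv1 hz1
  have hclose : ∀ w, w < orderStat x n → |ecdf x w - F w| < min (e / 2) 1 →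
      |L (LambdaTilde x w) - F w| < e := by
    intro w hw hTw
    rcases le_or_gt w 0 with hw0 | hw0
    · simpa [LambdaTilde_of_nonpos hw0, h0 w hw0, L] using he
    · have h1 := le_KS x hw0
      rw [Ftilde, if_pos hw] at h1
      rw [abs_sub_comm] at h1
      have h2 := abs_sub_le (L (LambdaTilde x w)) (ecdf x w) (F w)
      linarith
  obtain ⟨hlt', -, -, -⟩ := key _ _ _ (hclose u hu1 hTu) (hclose v hv1 hTv) (hclose z hz1 hTz)
  rw [odds_L (LambdaTilde_nonneg hn hx hpos hu1), odds_L (LambdaTilde_nonneg hn hx hpos hv1),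
    odds_L (LambdaTilde_nonneg hn hx hpos hz1)] at hlt'
  exact hlt'.not_ge ((LambdaTilde_convexOn hn hx hpos).2 hu1 hv1 ha hb hab)

/-! ### The mean square error of the empirical distribution function -/

section SecondMoment

variable (ν : Measure ℝ) [IsProbabilityMeasure ν] (n : ℕ)

lemma measurable_ecdf (t : ℝ) : Measurable fun y : Fin n → ℝ => ecdf y t := by
  unfold ecdf
  refine Measurable.div_const (Finset.measurable_sum _ fun i _ => ?_) _
  exact Measurable.ite (measurableSet_le (measurable_pi_apply i) measurable_const)
    measurable_const measurable_const

lemma ecdf_eq_sum_indicator (t : ℝ) :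
    (fun y : Fin n → ℝ => ecdf y t) =
      fun y => (n : ℝ)⁻¹ * (∑ i, fun y : Fin n → ℝ => (Iic t).indicator (1 : ℝ → ℝ) (y i)) y := by
  ext y
  simp [ecdf, indicator_apply, div_eq_inv_mul]

lemma memLp_indicator_Iic (t : ℝ) : MemLp ((Iic t).indicator (1 : ℝ → ℝ)) 2 ν :=
  (memLp_const (1 : ℝ)).indicator measurableSet_Iic

lemma memLp_ecdf (t : ℝ) :
    MemLp (fun y : Fin n → ℝ => ecdf y t) 2 (Measure.pi fun _ : Fin n => ν) :=
  MemLp.of_bound (measurable_ecdf n t).aestronglyMeasurable 1 (Eventually.of_forall fun y => by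
    rw [Real.norm_of_nonneg (ecdf_nonneg y t)]; exact ecdf_le_one y t)

lemma integral_ecdf (hn : 1 ≤ n) (t : ℝ) :
    ∫ y, ecdf y t ∂(Measure.pi fun _ : Fin n => ν) = cdf ν t := by
  have hn' : (n : ℝ) ≠ 0 := by positivity
  have h (i : Fin n) : ∫ y : Fin n → ℝ, (Iic t).indicator (1 : ℝ → ℝ) (y i)
      ∂(Measure.pi fun _ : Fin n => ν) = cdf ν t := by
    rw [integral_comp_eval (μ := fun _ : Fin n => ν) (i := i)
      ((memLp_indicator_Iic ν t).aestronglyMeasurable), integral_indicator_one measurableSet_Iic,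
      cdf_eq_real]
  rw [ecdf_eq_sum_indicator, integral_const_mul]
  simp only [Finset.sum_apply]
  rw [integral_finsetSum]
  · simp only [h, Finset.sum_const, Finset.card_univ, Fintype.card_fin, nsmul_eq_mul]
    field_simp
  · exact fun i _ => ((memLp_indicator_Iic ν t).comp_measurePreserving
      (measurePreserving_eval _ i)).integrable one_le_two

lemma variance_ecdf_le (hn : 1 ≤ n) (t : ℝ) :
    Var[fun y : Fin n → ℝ => ecdf y t; Measure.pi fun _ : Fin n => ν] ≤ (1 - cdf ν t) / n := by
  have hn' : (0 : ℝ) < n := by exact_mod_cast hn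
  have hsq : ((Iic t).indicator (1 : ℝ → ℝ)) ^ 2 = (Iic t).indicator (1 : ℝ → ℝ) := by
    ext y
    by_cases hy : y ≤ t <;> simp [hy]
  have h1 : Var[(Iic t).indicator (1 : ℝ → ℝ); ν] ≤ 1 - cdf ν t := by
    rw [variance_eq_sub (memLp_indicator_Iic ν t), hsq, integral_indicator_one measurableSet_Iic,
      ← cdf_eq_real]
    nlinarith [cdf_nonneg ν t, cdf_le_one ν t]
  rw [ecdf_eq_sum_indicator, variance_const_mul,
    variance_sum_pi (fun _ : Fin n => memLp_indicator_Iic ν t)]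
  simp only [Finset.sum_const, Finset.card_univ, Fintype.card_fin, nsmul_eq_mul]
  calc (n : ℝ)⁻¹ ^ 2 * (n * Var[(Iic t).indicator (1 : ℝ → ℝ); ν])
      = Var[(Iic t).indicator (1 : ℝ → ℝ); ν] / n := by field_simp
    _ ≤ _ := by gcongr

lemma lintegral_ecdf_sub_sq_le (hn : 1 ≤ n) (t : ℝ) :
    ∫⁻ y, ENNReal.ofReal ((ecdf y t - cdf ν t) ^ 2) ∂(Measure.pi fun _ : Fin n => ν) ≤
      ENNReal.ofReal ((1 - cdf ν t) / n) := by
  refine le_trans (Eq.le ?_) (ENNReal.ofReal_le_ofReal (variance_ecdf_le ν n hn t))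
  rw [ofReal_variance (memLp_ecdf ν n t), evariance_eq_lintegral_ofReal, integral_ecdf ν n hn t]

/-- The weak law of large numbers for the empirical distribution function at finitely many
points. -/
lemma tendsto_measure_ecdf_far (T : Finset ℝ) {δ : ℝ} (hδ : 0 < δ) :
    Tendsto (fun n : ℕ => (Measure.pi fun _ : Fin n => ν)
      {y | ∃ u ∈ T, δ ≤ |ecdf y u - cdf ν u|}) atTop (𝓝 0) := by
  have hlim : Tendsto (fun n : ℕ => T.card * ENNReal.ofReal (1 / n / δ ^ 2)) atTop (𝓝 0) := by
    have h1 : Tendsto (fun n : ℕ => (1 : ℝ) / n / δ ^ 2) atTop (𝓝 (0 / δ ^ 2)) :=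
      tendsto_one_div_atTop_nhds_zero_nat.div_const _
    have h2 := ENNReal.Tendsto.const_mul (a := (T.card : ENNReal)) (ENNReal.tendsto_ofReal h1)
      (Or.inr (ENNReal.natCast_ne_top _))
    simpa using h2
  refine tendsto_of_tendsto_of_tendsto_of_le_of_le' tendsto_const_nhds hlim
    (Eventually.of_forall fun _ => zero_le) ?_
  filter_upwards [eventually_ge_atTop 1] with n hn
  have hset : {y : Fin n → ℝ | ∃ u ∈ T, δ ≤ |ecdf y u - cdf ν u|} =
      ⋃ u ∈ T, {y | δ ≤ |ecdf y u - cdf ν u|} := by ext; simp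
  rw [hset]
  refine (measure_biUnion_finset_le _ _).trans ((Finset.sum_le_card_nsmul _ _ _ fun u _ => ?_).trans
    (nsmul_eq_mul _ _).le)
  have h := meas_ge_le_variance_div_sq (memLp_ecdf ν n u) hδ
  rw [integral_ecdf ν n hn u] at h
  refine h.trans (ENNReal.ofReal_le_ofReal ?_)
  have h2 := variance_ecdf_le ν n hn u
  gcongr
  refine h2.trans ?_
  gcongr
  linarith [cdf_nonneg ν u]

lemma ae_sample_nonneg (hsupp : ν (Iio 0) = 0) :
    ∀ᵐ y ∂(Measure.pi fun _ : Fin n => ν), ∀ i, 0 ≤ y i := by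
  refine ae_all_iff.2 fun i => ?_
  have : ∀ᵐ z ∂ν, 0 ≤ z := by
    rw [ae_iff]
    simp only [not_le]
    exact hsupp
  exact (measurePreserving_eval (fun _ : Fin n => ν) i).quasiMeasurePreserving.ae this

end SecondMoment

/-! ### The log-logistic distribution: a sample close to it has a small statistic -/

lemma L_of_nonneg {t : ℝ} (ht : 0 ≤ t) : L t = t / (1 + t) := by
  rw [L, max_eq_left ht]

lemma one_sub_L_of_nonneg {t : ℝ} (ht : 0 ≤ t) : 1 - L t = (1 + t)⁻¹ := by
  rw [L_eq, max_eq_left ht]; ring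

lemma L_le_one_sub_iff {t η : ℝ} (ht : 0 ≤ t) (hη : 0 < η) : L t ≤ 1 - η ↔ t ≤ (1 - η) / η := by
  rw [L_of_nonneg ht, div_le_iff₀ (by linarith), le_div_iff₀ hη]
  constructor <;> intro h <;> nlinarith

lemma L_div_one_sub {u : ℝ} (h0 : 0 ≤ u) (h1 : u < 1) : L (u / (1 - u)) = u := by
  have : 1 - u ≠ 0 := by linarith
  rw [L_of_nonneg (div_nonneg h0 (by linarith))]
  field_simp
  ring

lemma L_add_le {a b : ℝ} (ha : 0 ≤ a) (hb : 0 ≤ b) : L (a + b) ≤ a + L b := by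
  rw [L_of_nonneg (add_nonneg ha hb), L_of_nonneg hb, ← sub_nonneg]
  have : a + b / (1 + b) - (a + b) / (1 + (a + b)) =
      a * (1 - 1 / ((1 + b) * (1 + (a + b)))) := by
    field_simp
    ring
  rw [this]
  refine mul_nonneg ha (sub_nonneg.2 (div_le_one_of_le₀ ?_ (by positivity)))
  nlinarith [mul_nonneg ha hb, mul_nonneg hb hb]

lemma L_mul_le {c a : ℝ} (hc : 1 ≤ c) (ha : 0 ≤ a) : L (c * a) ≤ c * L a := by
  have hc0 : 0 ≤ c := by linarith
  rw [L_of_nonneg (mul_nonneg hc0 ha), L_of_nonneg ha, ← mul_div_assoc]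
  gcongr
  nlinarith

/-- For the log-logistic distribution the transform is the identity in the variable `L t`. -/
lemma integral_one_sub_L_sq {t : ℝ} (ht : 0 ≤ t) : ∫ s in (0 : ℝ)..t, (1 - L s) ^ 2 = L t := by
  have h : ∀ s ∈ uIcc 0 t, HasDerivAt (fun s : ℝ => -(1 + s)⁻¹) ((1 - L s) ^ 2) s := by
    intro s hs
    rw [uIcc_of_le ht] at hs
    have h1 : (1 + s) ≠ 0 := by linarith [hs.1]
    rw [one_sub_L_of_nonneg hs.1]
    refine (((hasDerivAt_id' s).const_add 1).fun_inv h1).fun_neg.congr_deriv ?_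
    field_simp
  rw [intervalIntegral.integral_eq_sub_of_hasDerivAt h
    (((continuous_const.sub L_continuous).pow 2).intervalIntegrable _ _), L_eq, max_eq_left ht]
  ring

section Consistency

variable {n : ℕ} {x : Fin n → ℝ} {δ R η : ℝ}

lemma intervalIntegrable_ecdf_sub_L_sq (x : Fin n → ℝ) (a b : ℝ) :
    IntervalIntegrable (fun t => (ecdf x t - L t) ^ 2) volume a b := by
  have hL : Continuous fun t => 1 - L t := continuous_const.sub L_continuous
  have hE : IntervalIntegrable (fun t => 1 - ecdf x t) volume a b :=
    intervalIntegrable_const.sub (ecdf_mono x).intervalIntegrable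
  have h := ((intervalIntegrable_one_sub_ecdf_sq x a b).sub
    ((hE.mul_continuousOn hL.continuousOn).const_mul 2)).add ((hL.pow 2).intervalIntegrable a b)
  refine h.congr fun t _ => ?_
  simp only [Pi.pow_apply]
  ring

/-- Closeness of the transform in terms of the `L²` distance of the distribution functions. The
weight `δ` in the arithmetic-geometric mean inequality
`2 (1 - L) |𝔽ₙ - L| ≤ δ (1 - L) ^ 2 + (𝔽ₙ - L) ^ 2 / δ` exploits the integrability of
`(1 - L) ^ 2`, so that the bound does not depend on `R`. -/
lemma abs_integral_sub_L_le (hδ : 0 < δ) (hδ1 : δ ≤ 1)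
    (hD : ∫ t in (0 : ℝ)..R, (ecdf x t - L t) ^ 2 ≤ δ ^ 2) {t : ℝ} (ht : 0 ≤ t) (htR : t ≤ R) :
    |(∫ s in (0 : ℝ)..t, (1 - ecdf x s) ^ 2) - L t| ≤ 3 * δ := by
  have hL : Continuous fun t => 1 - L t := continuous_const.sub L_continuous
  have hI1 := intervalIntegrable_one_sub_ecdf_sq x 0 t
  have hI2 : IntervalIntegrable (fun s => (1 - L s) ^ 2) volume 0 t :=
    (hL.pow 2).intervalIntegrable 0 t
  have hI3 := intervalIntegrable_ecdf_sub_L_sq x 0 t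
  have hB : IntervalIntegrable
      (fun s => δ * (1 - L s) ^ 2 + (1 + δ⁻¹) * (ecdf x s - L s) ^ 2) volume 0 t :=
    (hI2.const_mul δ).add (hI3.const_mul _)
  have hDt : ∫ s in (0 : ℝ)..t, (ecdf x s - L s) ^ 2 ≤ δ ^ 2 := by
    refine le_trans ?_ hD
    exact intervalIntegral.integral_mono_interval le_rfl ht htR
      (Eventually.of_forall fun _ => sq_nonneg _) (intervalIntegrable_ecdf_sub_L_sq x 0 R)
  have hBi : ∫ s in (0 : ℝ)..t, (δ * (1 - L s) ^ 2 + (1 + δ⁻¹) * (ecdf x s - L s) ^ 2) ≤ 3 * δ := by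
    rw [intervalIntegral.integral_add (hI2.const_mul δ) (hI3.const_mul _),
      intervalIntegral.integral_const_mul, intervalIntegral.integral_const_mul,
      integral_one_sub_L_sq ht]
    have h1 : δ * L t ≤ δ := mul_le_of_le_one_right hδ.le (L_lt_one t).le
    have h2 : (1 + δ⁻¹) * ∫ s in (0 : ℝ)..t, (ecdf x s - L s) ^ 2 ≤ (1 + δ⁻¹) * δ ^ 2 := by
      gcongr
    have h3 : (1 + δ⁻¹) * δ ^ 2 = δ ^ 2 + δ := by
      field_simp
    nlinarith
  rw [← integral_one_sub_L_sq ht, ← intervalIntegral.integral_sub hI1 hI2]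
  refine (intervalIntegral.abs_integral_le_integral_abs ht).trans (le_trans ?_ hBi)
  refine intervalIntegral.integral_mono_on ht (hI1.sub hI2).abs hB fun s _ => ?_
  set u := 1 - L s
  set d := ecdf x s - L s
  have e1 : (1 - ecdf x s) ^ 2 - u ^ 2 = d ^ 2 - 2 * (u * d) := by ring
  have e2 : δ * u ^ 2 + δ⁻¹ * d ^ 2 - 2 * (u * d) = δ⁻¹ * (δ * u - d) ^ 2 := by
    field_simp
    ring
  have e3 : δ * u ^ 2 + δ⁻¹ * d ^ 2 + 2 * (u * d) = δ⁻¹ * (δ * u + d) ^ 2 := by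
    field_simp
    ring
  have e4 : 0 ≤ δ⁻¹ * (δ * u - d) ^ 2 := by positivity
  have e5 : 0 ≤ δ⁻¹ * (δ * u + d) ^ 2 := by positivity
  have e6 := sq_nonneg d
  have e7 : 0 ≤ δ * u ^ 2 := by positivity
  have e8 : 0 ≤ δ⁻¹ * d ^ 2 := by positivity
  rw [e1, abs_le]
  constructor <;> linarith

/-- At the nodes the empirical transform is close to the identity. -/
lemma abs_TinvNode_sub_le (hδ : 0 < δ) (hδ1 : δ ≤ 1) (hx : ∀ i, 0 ≤ x i)
    (hxR : ∀ i, x i ≤ R) (hGC : ∀ t, 0 ≤ t → |ecdf x t - L t| ≤ δ)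
    (hD : ∫ t in (0 : ℝ)..R, (ecdf x t - L t) ^ 2 ≤ δ ^ 2) {k : ℕ} (hk : k ≤ n) :
    |TinvNode x k - k / n| ≤ 4 * δ := by
  rcases Nat.eq_zero_or_pos k with rfl | hk0
  · simpa [TinvNode, orderStat] using hδ.le
  have hn : (0 : ℝ) < n := by exact_mod_cast hk0.trans_le hk
  have hX0 := orderStat_nonneg hx k
  have hXR : orderStat x k ≤ R := by
    rw [orderStat, dif_pos ⟨hk0, hk⟩]
    exact hxR _
  have h1 := abs_le.1 (abs_integral_sub_L_le hδ hδ1 hD hX0 hXR)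
  have h2 : (k : ℝ) / n ≤ L (orderStat x k) + δ := by
    have h3 := (abs_le.1 (hGC _ hX0)).2
    have h4 := (orderStat_le_iff (x := x) hk0 hk _).1 le_rfl
    have h5 : (k : ℝ) / n ≤ ecdf x (orderStat x k) := by
      rw [ecdf_eq_card]
      gcongr
    linarith
  have h3 : L (orderStat x k) - δ ≤ k / n := by
    rcases hX0.eq_or_lt with h0 | h0
    · rw [← h0]
      have : (0 : ℝ) ≤ k / n := by positivity
      simp only [L, max_self, zero_div]
      linarith
    -- To the left of `X_(k)` fewer than `k` observations are counted.
    have hlim : Tendsto (fun t => L t - δ) (𝓝[<] (orderStat x k)) (𝓝 (L (orderStat x k) - δ)) :=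
      ((L_continuous.tendsto _).sub_const δ).mono_left nhdsWithin_le_nhds
    refine le_of_tendsto hlim ?_
    filter_upwards [self_mem_nhdsWithin, mem_nhdsWithin_of_mem_nhds (lt_mem_nhds h0)] with t ht ht0
    have h4 : ¬ k ≤ Finset.card {i | x i ≤ t} := by
      rw [← orderStat_le_iff hk0 hk, not_le]
      exact ht
    have h5 : ecdf x t ≤ k / n := by
      rw [ecdf_eq_card]
      gcongr
      exact (not_le.1 h4).le
    have h6 := (abs_le.1 (hGC t ht0.le)).1
    linarith
  rw [TinvNode, abs_le]
  constructor <;> linarith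

lemma abs_lcm_Tinv_sub_le (hn : 1 ≤ n) (hx : ∀ i, 0 ≤ x i) {e : ℝ}
    (he : ∀ p ∈ Icc (0 : ℝ) 1, |Tinv x p - p| ≤ e) {p : ℝ} (hp : p ∈ Icc (0 : ℝ) 1) :
    |leastConcaveMajorant (Icc 0 1) (Tinv x) p - p| ≤ e := by
  have h1 := Tinv_le_lcm hn hx hp
  have h2 : leastConcaveMajorant (Icc 0 1) (Tinv x) p ≤ p + e := by
    refine leastConcaveMajorant_le
      ((concaveOn_id (convex_Icc 0 1)).add (concaveOn_const e (convex_Icc 0 1))) (fun q hq => ?_) hp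
    have := (abs_le.1 (he q hq)).2
    simp only [Pi.add_apply, id]
    linarith
  have h3 := (abs_le.1 (he p hp)).1
  rw [abs_le]
  constructor <;> linarith

lemma lambdaTilde_le (hn : 1 ≤ n) (hx : ∀ i, 0 ≤ x i) (hη : 0 < η) (hη1 : η < 1)
    (hg : ∀ p ∈ Icc (0 : ℝ) 1, |leastConcaveMajorant (Icc 0 1) (Tinv x) p - p| ≤ η ^ 2 / 2)
    {t : ℝ} (ht : ecdf x t ≤ 1 - η) : lambdaTilde x t ≤ 1 / (1 - η) := by
  have hpos : 0 ≤ 1 / (1 - η) := one_div_nonneg.2 (by linarith)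
  unfold lambdaTilde
  split_ifs
  · exact hpos
  have h0 := ecdf_nonneg x t
  by_cases hd : DifferentiableWithinAt ℝ (leastConcaveMajorant (Icc 0 1) (Tinv x))
    (Ioi (ecdf x t)) (ecdf x t)
  · refine one_div_le_one_div_of_le (by linarith) ?_
    have hp : ecdf x t ∈ Icc (0 : ℝ) 1 := ⟨h0, ecdf_le_one x t⟩
    have hp' : ecdf x t + η ∈ Icc (0 : ℝ) 1 := ⟨by linarith, by linarith⟩
    refine le_trans ?_ ((concaveOn_lcm_Tinv hn hx).slope_le_rightDeriv hp hp' (by linarith) hd)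
    have h1 := (abs_le.1 (hg _ hp)).2
    have h2 := (abs_le.1 (hg _ hp')).1
    rw [slope_def_field, add_sub_cancel_left, le_div_iff₀ hη]
    nlinarith
  · rwa [show lcmSlope x (ecdf x t) = 0 from derivWithin_zero_of_not_differentiableWithinAt hd,
      div_zero]

lemma le_lambdaTilde (hn : 1 ≤ n) (hx : ∀ i, 0 ≤ x i) (hη : 0 < η)
    (hg : ∀ p ∈ Icc (0 : ℝ) 1, |leastConcaveMajorant (Icc 0 1) (Tinv x) p - p| ≤ η ^ 2 / 2)
    {t : ℝ} (ht0 : 0 < t) (htn : t < orderStat x n) (ht : η ≤ ecdf x t) :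
    1 / (1 + η) ≤ lambdaTilde x t := by
  have hp1 := (lt_orderStat_iff_ecdf_lt_one hn t).1 htn
  have hp0 : 0 < ecdf x t := hη.trans_le ht
  rw [lambdaTilde, if_neg ht0.not_ge]
  refine one_div_le_one_div_of_le (lcmSlope_ecdf_pos hn hx ht0.le htn hp0) ?_
  have hp : ecdf x t ∈ Icc (0 : ℝ) 1 := ⟨hp0.le, hp1.le⟩
  have hp' : ecdf x t - η ∈ Icc (0 : ℝ) 1 := ⟨by linarith, by linarith⟩
  refine (rightDeriv_le_slope_left (concaveOn_lcm_Tinv hn hx) hp'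
    (by rw [interior_Icc]; exact ⟨hp0, hp1⟩) (by linarith)).trans ?_
  have h1 := (abs_le.1 (hg _ hp)).2
  have h2 := (abs_le.1 (hg _ hp')).1
  rw [sub_sub_cancel, div_le_iff₀ hη]
  nlinarith

/-- To the left of the point `(1 - 2 * η) / (2 * η)`, the quantile of `L` of order `1 - 2 * η`, the
estimator is close to `L`: its odds rate is at most `1 / (1 - η)` there, and at least `1 / (1 + η)`
from the quantile of order `2 * η` on. -/
lemma abs_L_LambdaTilde_sub_le (hn : 1 ≤ n) (hx : ∀ i, 0 ≤ x i) (hη : 0 < η) (hη1 : η ≤ 1 / 4)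
    (hg : ∀ p ∈ Icc (0 : ℝ) 1, |leastConcaveMajorant (Icc 0 1) (Tinv x) p - p| ≤ η ^ 2 / 2)
    (hGC : ∀ t, 0 ≤ t → |ecdf x t - L t| ≤ η) {t : ℝ} (ht0 : 0 < t) (htn : t < orderStat x n)
    (ht : L t ≤ 1 - 2 * η) : |L (LambdaTilde x t) - L t| ≤ 5 * η := by
  have hpos : 0 < orderStat x n := ht0.trans htn
  have hv := LambdaTilde_nonneg hn hx hpos htn
  have hL0 := L_nonneg (LambdaTilde x t)
  have hL1 := L_lt_one (LambdaTilde x t)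
  have hup : LambdaTilde x t ≤ 1 / (1 - η) * t := by
    refine (intervalIntegral.integral_mono_on ht0.le (lambdaTilde_intervalIntegrable hn hx hpos htn)
      (intervalIntegrable_const (c := 1 / (1 - η))) fun s hs => ?_).trans_eq ?_
    · refine lambdaTilde_le hn hx hη (by linarith) hg ?_
      have h1 := (abs_le.1 (hGC s hs.1)).2
      have h2 := L_mono hs.2
      linarith
    · rw [intervalIntegral.integral_const, smul_eq_mul, sub_zero, mul_comm]
  set r := 2 * η / (1 - 2 * η) with hr
  have hr0 : 0 < r := div_pos (by linarith) (by linarith)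
  have hLr : L r = 2 * η := L_div_one_sub (by linarith) (by linarith)
  have hr4 : r ≤ 4 * η := by
    rw [hr, div_le_iff₀ (by linarith)]
    nlinarith
  have hlow : t ≤ r + (1 + η) * LambdaTilde x t := by
    rcases le_or_gt t r with h | h
    · have : 0 ≤ (1 + η) * LambdaTilde x t := mul_nonneg (by linarith) hv
      linarith
    have hrn : r < orderStat x n := h.trans htn
    have h1 : 1 / (1 + η) * (t - r) ≤ LambdaTilde x t - LambdaTilde x r := by
      rw [LambdaTilde_sub hn hx hpos hrn htn]
      refine Eq.trans_le ?_ (intervalIntegral.integral_mono_on h.le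
        (intervalIntegrable_const (c := 1 / (1 + η)))
        (lambdaTilde_intervalIntegrable hn hx hrn htn) fun s hs => ?_)
      · rw [intervalIntegral.integral_const, smul_eq_mul, mul_comm]
      · have hs0 : 0 < s := hr0.trans_le hs.1
        refine le_lambdaTilde hn hx hη hg hs0 (hs.2.trans_lt htn) ?_
        have h1 := (abs_le.1 (hGC s hs0.le)).1
        have h2 := L_mono hs.1
        linarith
    have h2 := LambdaTilde_nonneg hn hx hpos hrn
    have h3 : t - r ≤ (1 + η) * (LambdaTilde x t - LambdaTilde x r) := by
      rw [div_mul_eq_mul_div, one_mul, div_le_iff₀ (by linarith)] at h1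
      linarith
    nlinarith
  have h1 : L t ≤ r + (1 + η) * L (LambdaTilde x t) :=
    (L_mono hlow).trans ((L_add_le hr0.le (mul_nonneg (by linarith) hv)).trans
      (by gcongr; exact L_mul_le (by linarith) hv))
  have h2 : L (LambdaTilde x t) ≤ (1 + 2 * η) * L t := by
    refine (L_mono (hup.trans ?_)).trans (L_mul_le (by linarith) ht0.le)
    gcongr
    rw [div_le_iff₀ (by linarith)]
    nlinarith
  have h3 := L_lt_one t
  rw [abs_le]
  constructor <;> nlinarith

/-- A sample close to the log-logistic distribution has a small statistic. -/
lemma KS_le_of_close (hn : 1 ≤ n) (hx : ∀ i, 0 ≤ x i) (hη : 0 < η) (hη1 : η ≤ 1 / 4)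
    (hxR : ∀ i, x i ≤ R) (hGC : ∀ t, 0 ≤ t → |ecdf x t - L t| ≤ η ^ 2 / 8)
    (hD : ∫ t in (0 : ℝ)..R, (ecdf x t - L t) ^ 2 ≤ (η ^ 2 / 8) ^ 2) : KS x ≤ 7 * η := by
  have hGC' : ∀ t, 0 ≤ t → |ecdf x t - L t| ≤ η := fun t ht => (hGC t ht).trans (by nlinarith)
  have hg : ∀ p ∈ Icc (0 : ℝ) 1,
      |leastConcaveMajorant (Icc 0 1) (Tinv x) p - p| ≤ η ^ 2 / 2 := by
    refine fun p hp => abs_lcm_Tinv_sub_le hn hx (fun q hq => ?_) hp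
    refine abs_Tinv_sub_le hn (fun k hk => ?_) hq
    refine (abs_TinvNode_sub_le (by positivity) (by nlinarith) hx hxR hGC hD hk).trans_eq ?_
    ring
  refine KS_le fun t ht0 => ?_
  rcases le_or_gt (orderStat x n) t with htn | htn
  · have h1 := (lt_orderStat_iff_ecdf_lt_one hn t).not.1 htn.not_gt
    rw [Ftilde, if_neg htn.not_gt, le_antisymm (ecdf_le_one x t) (not_lt.1 h1)]
    simpa using hη.le
  rw [Ftilde, if_pos htn]
  have h1 := abs_le.1 (hGC' t ht0.le)
  rcases le_or_gt (L t) (1 - 2 * η) with ht | ht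
  · have h2 := abs_le.1 (abs_L_LambdaTilde_sub_le hn hx hη hη1 hg hGC' ht0 htn ht)
    rw [abs_le]
    constructor <;> linarith [h1.1, h1.2, h2.1, h2.2]
  -- In the tail both functions are at least their values at the quantile of order `1 - 2 * η`.
  · have hs0 : 0 < (1 - 2 * η) / (2 * η) := div_pos (by linarith) (by linarith)
    set s := (1 - 2 * η) / (2 * η) with hs
    have hLs : L s = 1 - 2 * η := by
      have := L_div_one_sub (u := 1 - 2 * η) (by linarith) (by linarith)
      rwa [sub_sub_cancel] at this
    have hst : s < t := by
      rw [← not_le, hs, ← L_le_one_sub_iff ht0.le (by linarith)]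
      exact ht.not_ge
    have hsn := hst.trans htn
    have h2 := abs_le.1 (abs_L_LambdaTilde_sub_le hn hx hη hη1 hg hGC' hs0 hsn hLs.le)
    have h3 := L_mono (LambdaTilde_monotoneOn hn hx (hs0.trans hsn) hsn htn hst.le)
    have h4 := ecdf_le_one x t
    have h5 := L_lt_one (LambdaTilde x t)
    rw [abs_le]
    constructor <;> linarith [h1.1, h2.1]

end Consistency

/-! ### Samples from the log-logistic distribution are close to it -/

lemma cdf_LL1 (t : ℝ) : cdf LL1 t = L t := by
  rw [LL1, cdf_measure_stieltjesFunction LStieltjes L_tendsto_atBot L_tendsto_atTop]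
  rfl

lemma LL1_Iio_zero : LL1 (Iio 0) = 0 := by
  refine measure_mono_null Iio_subset_Iic_self ?_
  rw [← ofReal_cdf LL1 0, cdf_LL1]
  simp [L]

lemma LL1_Ioi (t : ℝ) : LL1 (Ioi t) = ENNReal.ofReal (1 - L t) := by
  rw [← compl_Iic, prob_compl_eq_one_sub measurableSet_Iic, ← ofReal_cdf LL1 t, cdf_LL1,
    ENNReal.ofReal_sub _ (L_nonneg t), ENNReal.ofReal_one]

/-- The quantiles of `L` of orders `j / m`, `j < m`. -/
noncomputable def quantileGrid (m : ℕ) : Finset ℝ :=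
  (Finset.range m).image fun j : ℕ => (j / m : ℝ) / (1 - j / m)

/-- By monotonicity, closeness to `L` at the quantiles of orders `j / m` implies closeness
everywhere. -/
lemma abs_ecdf_sub_L_le {n m : ℕ} (hm : 1 ≤ m) {x : Fin n → ℝ}
    (h : ∀ u ∈ quantileGrid m, |ecdf x u - L u| < 1 / m) {t : ℝ} (ht : 0 ≤ t) :
    |ecdf x t - L t| ≤ 2 / m := by
  have hm' : (0 : ℝ) < m := by exact_mod_cast hm
  have hgrid : ∀ j : ℕ, j < m → ∃ u, 0 ≤ u ∧ L u = j / m ∧ |ecdf x u - j / m| < 1 / m := by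
    intro j hj
    have h1 : (j : ℝ) / m < 1 := (div_lt_one hm').2 (by exact_mod_cast hj)
    have h0 : (0 : ℝ) ≤ j / m := by positivity
    have hL := L_div_one_sub h0 h1
    refine ⟨_, div_nonneg h0 (by linarith), hL, ?_⟩
    have := h ((j / m : ℝ) / (1 - j / m))
      (Finset.mem_image_of_mem (fun j : ℕ => (j / m : ℝ) / (1 - j / m)) (Finset.mem_range.2 hj))
    rwa [hL] at this
  have hle : ∀ u, 0 ≤ u → L u ≤ L t → u ≤ t := by
    intro u hu hut
    rw [L_of_nonneg hu, L_of_nonneg ht, div_le_div_iff₀ (by linarith) (by linarith)] at hut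
    nlinarith
  have hlt : ∀ u, 0 ≤ u → L t < L u → t ≤ u := fun u _ hut =>
    (lt_of_not_ge fun hut' => (L_mono hut').not_gt hut).le
  have hL0 := L_nonneg t
  set j := ⌊m * L t⌋₊ with hj
  have hj1 : (j : ℝ) ≤ m * L t := Nat.floor_le (by positivity)
  have hj2 : m * L t < j + 1 := Nat.lt_floor_add_one _
  have hjm : j < m := by
    have : (j : ℝ) < m := hj1.trans_lt (by nlinarith [L_lt_one t])
    exact_mod_cast this
  have hj3 : (j : ℝ) / m ≤ L t := by rw [div_le_iff₀ hm']; linarith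
  have hj4 : L t < j / m + 1 / m := by rw [← add_div, lt_div_iff₀ hm']; linarith
  have e2 : (2 : ℝ) / m = 1 / m + 1 / m := by ring
  obtain ⟨u, hu0, hLu, hu⟩ := hgrid j hjm
  have h1 := ecdf_mono x (hle u hu0 (hLu.le.trans hj3))
  have h2 := abs_lt.1 hu
  rw [abs_le]
  refine ⟨by linarith, ?_⟩
  rcases eq_or_lt_of_le (Nat.succ_le_of_lt hjm) with hjm | hjm
  · have h3 : (j : ℝ) / m + 1 / m = 1 := by
      rw [← add_div, div_eq_one_iff_eq hm'.ne']
      exact_mod_cast hjm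
    have h4 := ecdf_le_one x t
    have h5 : (0 : ℝ) < 1 / m := by positivity
    linarith
  · obtain ⟨v, hv0, hLv, hv⟩ := hgrid (j + 1) hjm
    push_cast at hLv hv
    rw [add_div] at hLv hv
    have h3 := ecdf_mono x (hlt v hv0 (by rw [hLv]; exact hj4))
    have h4 := abs_lt.1 hv
    linarith

/-- The Glivenko–Cantelli theorem for the log-logistic distribution, in probability. -/
lemma tendsto_measure_not_close {δ : ℝ} (hδ : 0 < δ) :
    Tendsto (fun n : ℕ => (Measure.pi fun _ : Fin n => LL1)
      {y | ∃ t, 0 ≤ t ∧ δ < |ecdf y t - L t|}) atTop (𝓝 0) := by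
  obtain ⟨m, hm⟩ := exists_nat_gt (2 / δ)
  have hm0 : (0 : ℝ) < m := (by positivity : 0 < 2 / δ).trans hm
  have hm1 : 1 ≤ m := by exact_mod_cast hm0
  have hmδ : 2 / (m : ℝ) < δ := by
    rw [div_lt_iff₀ hδ] at hm
    rw [div_lt_iff₀ hm0]
    linarith
  refine tendsto_of_tendsto_of_tendsto_of_le_of_le tendsto_const_nhds
    (tendsto_measure_ecdf_far LL1 (quantileGrid m) (one_div_pos.2 hm0)) (fun _ => zero_le)
    fun n => measure_mono ?_
  rintro y ⟨t, ht, hty⟩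
  by_contra hcon
  simp only [mem_ofPred_eq, not_exists, not_and, not_le, cdf_LL1] at hcon
  exact (hmδ.trans hty).not_ge (abs_ecdf_sub_L_le hm1 hcon ht)

/-- With high probability a log-logistic sample of size `n` does not exceed `n ^ 2`. -/
lemma tendsto_measure_exists_gt :
    Tendsto (fun n : ℕ => (Measure.pi fun _ : Fin n => LL1) {y | ∃ i, (n : ℝ) ^ 2 < y i})
      atTop (𝓝 0) := by
  have hlim : Tendsto (fun n : ℕ => ENNReal.ofReal (1 / n)) atTop (𝓝 0) := by
    simpa using ENNReal.tendsto_ofReal tendsto_one_div_atTop_nhds_zero_nat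
  refine tendsto_of_tendsto_of_tendsto_of_le_of_le' tendsto_const_nhds hlim
    (Eventually.of_forall fun _ => zero_le) ?_
  filter_upwards [eventually_ge_atTop 1] with n hn
  have hn' : (0 : ℝ) < n := by exact_mod_cast hn
  have hi : ∀ i : Fin n, (Measure.pi fun _ : Fin n => LL1) {y | (n : ℝ) ^ 2 < y i} =
      ENNReal.ofReal (1 - L ((n : ℝ) ^ 2)) := fun i => by
    rw [← LL1_Ioi]
    exact (measurePreserving_eval (fun _ : Fin n => LL1) i).measure_preimage
      measurableSet_Ioi.nullMeasurableSet
  rw [show {y : Fin n → ℝ | ∃ i, (n : ℝ) ^ 2 < y i} = ⋃ i, {y | (n : ℝ) ^ 2 < y i} by ext; simp]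
  refine (measure_iUnion_fintype_le _ _).trans ?_
  simp only [hi, Finset.sum_const, Finset.card_univ, Fintype.card_fin]
  rw [← ENNReal.ofReal_nsmul]
  refine ENNReal.ofReal_le_ofReal ?_
  rw [nsmul_eq_mul, one_sub_L_of_nonneg (by positivity), ← div_eq_mul_inv,
    div_le_div_iff₀ (by positivity) hn']
  nlinarith

lemma integral_one_sub_L {R : ℝ} (hR : 0 ≤ R) :
    ∫ t in (0 : ℝ)..R, (1 - L t) = Real.log (1 + R) := by
  have h : ∀ t ∈ uIcc 0 R, HasDerivAt (fun t : ℝ => Real.log (1 + t)) (1 - L t) t := by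
    intro t ht
    rw [uIcc_of_le hR] at ht
    rw [one_sub_L_of_nonneg ht.1, inv_eq_one_div]
    exact ((hasDerivAt_id' t).const_add 1).log (by linarith [ht.1])
  rw [intervalIntegral.integral_eq_sub_of_hasDerivAt h
    ((continuous_const.sub L_continuous).intervalIntegrable _ _)]
  simp

lemma measurable_uncurry_ecdf (n : ℕ) :
    Measurable fun z : (Fin n → ℝ) × ℝ => ecdf z.1 z.2 := by
  unfold ecdf
  refine Measurable.div_const (Finset.measurable_sum _ fun i _ => ?_) _
  exact Measurable.ite (measurableSet_le ((measurable_pi_apply i).comp measurable_fst)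
    measurable_snd) measurable_const measurable_const

lemma lintegral_lintegral_ecdf_sub_L_sq_le {n : ℕ} (hn : 1 ≤ n) {R : ℝ} (hR : 0 ≤ R) :
    ∫⁻ y, (∫⁻ t in Ioc 0 R, ENNReal.ofReal ((ecdf y t - L t) ^ 2))
      ∂(Measure.pi fun _ : Fin n => LL1) ≤ ENNReal.ofReal (Real.log (1 + R) / n) := by
  have hmeas : Measurable (Function.uncurry fun (y : Fin n → ℝ) (t : ℝ) =>
      ENNReal.ofReal ((ecdf y t - L t) ^ 2)) :=
    (((measurable_uncurry_ecdf n).sub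
      (L_continuous.measurable.comp measurable_snd)).pow_const 2).ennreal_ofReal
  rw [lintegral_lintegral_swap hmeas.aemeasurable]
  have hb : ∀ t, ∫⁻ y, ENNReal.ofReal ((ecdf y t - L t) ^ 2)
      ∂(Measure.pi fun _ : Fin n => LL1) ≤ ENNReal.ofReal ((1 - L t) / n) := fun t => by
    simpa only [cdf_LL1] using lintegral_ecdf_sub_sq_le LL1 n hn t
  refine (lintegral_mono hb).trans_eq ?_
  have hc : Continuous fun t => (1 - L t) / n := (continuous_const.sub L_continuous).div_const _
  rw [← integral_one_sub_L hR, ← intervalIntegral.integral_div, intervalIntegral.integral_of_le hR,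
    ofReal_integral_eq_lintegral_ofReal]
  · exact (hc.intervalIntegrable 0 R).1
  · exact Eventually.of_forall fun t =>
      div_nonneg (by linarith [L_lt_one t]) (Nat.cast_nonneg n)

lemma tendsto_log_one_add_sq_div :
    Tendsto (fun n : ℕ => Real.log (1 + (n : ℝ) ^ 2) / n) atTop (𝓝 0) := by
  have hlim : Tendsto (fun n : ℕ => 4 / √(n : ℝ)) atTop (𝓝 0) :=
    tendsto_const_nhds.div_atTop (Real.tendsto_sqrt_atTop.comp tendsto_natCast_atTop_atTop)
  refine tendsto_of_tendsto_of_tendsto_of_le_of_le' tendsto_const_nhds hlim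
    (Eventually.of_forall fun n => div_nonneg (Real.log_nonneg (by nlinarith)) (Nat.cast_nonneg n))
    ?_
  filter_upwards [eventually_ge_atTop 1] with n hn
  have hn' : (0 : ℝ) < n := by exact_mod_cast hn
  set r := √(n : ℝ) with hr
  have hr0 : 0 < r := Real.sqrt_pos.2 hn'
  have hrn : (n : ℝ) = r ^ 2 := (Real.sq_sqrt hn'.le).symm
  rw [hrn, div_le_div_iff₀ (by positivity) hr0]
  have h1 : Real.log (1 + (r ^ 2) ^ 2) ≤ 4 * Real.log (1 + r) := by
    rw [show 4 * Real.log (1 + r) = Real.log ((1 + r) ^ 4) by rw [Real.log_pow]; norm_num]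
    refine Real.log_le_log (by positivity) ?_
    have : (1 + r) ^ 4 = 1 + (r ^ 2) ^ 2 + (4 * r + 6 * r ^ 2 + 4 * r ^ 3) := by ring
    rw [this]
    have : 0 ≤ 4 * r + 6 * r ^ 2 + 4 * r ^ 3 := by positivity
    linarith
  have h2 : Real.log (1 + r) ≤ r := by
    have := Real.log_le_sub_one_of_pos (x := 1 + r) (by positivity)
    linarith
  nlinarith

/-- The `L²` distance between `𝔽ₙ` and `L` on `[0, n ^ 2]` tends to zero in probability. -/
lemma tendsto_measure_integral_sq_gt {e : ℝ} (he : 0 < e) :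
    Tendsto (fun n : ℕ => (Measure.pi fun _ : Fin n => LL1)
      {y | e < ∫ t in (0 : ℝ)..((n : ℝ) ^ 2), (ecdf y t - L t) ^ 2}) atTop (𝓝 0) := by
  have hlim : Tendsto (fun n : ℕ => ENNReal.ofReal (Real.log (1 + (n : ℝ) ^ 2) / n) /
      ENNReal.ofReal e) atTop (𝓝 0) := by
    have h := ENNReal.Tendsto.div_const (ENNReal.tendsto_ofReal tendsto_log_one_add_sq_div)
      (b := ENNReal.ofReal e) (Or.inr (ENNReal.ofReal_pos.2 he).ne')
    simpa using h
  refine tendsto_of_tendsto_of_tendsto_of_le_of_le' tendsto_const_nhds hlim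
    (Eventually.of_forall fun _ => zero_le) ?_
  filter_upwards [eventually_ge_atTop 1] with n hn
  have hR : (0 : ℝ) ≤ (n : ℝ) ^ 2 := by positivity
  have hmeas : Measurable fun y : Fin n → ℝ =>
      ∫⁻ t in Ioc 0 ((n : ℝ) ^ 2), ENNReal.ofReal ((ecdf y t - L t) ^ 2) :=
    Measurable.lintegral_prod_right' (f := fun z : (Fin n → ℝ) × ℝ =>
      ENNReal.ofReal ((ecdf z.1 z.2 - L z.2) ^ 2))
      (((measurable_uncurry_ecdf n).sub
        (L_continuous.measurable.comp measurable_snd)).pow_const 2).ennreal_ofReal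
  refine le_trans (measure_mono fun y hy => ?_)
    ((meas_ge_le_lintegral_div hmeas.aemeasurable (ENNReal.ofReal_pos.2 he).ne'
      ENNReal.ofReal_ne_top).trans
      (ENNReal.div_le_div_right (lintegral_lintegral_ecdf_sub_L_sq_le hn hR) _))
  simp only [mem_ofPred_eq] at hy ⊢
  rw [← ofReal_integral_eq_lintegral_ofReal (intervalIntegrable_ecdf_sub_L_sq y 0 _).1
    (Eventually.of_forall fun _ => sq_nonneg _), ← intervalIntegral.integral_of_le hR]
  exact ENNReal.ofReal_le_ofReal hy.le

/-- Under the log-logistic distribution the statistic tends to zero in probability. -/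
lemma tendsto_measure_le_KS {e : ℝ} (he : 0 < e) :
    Tendsto (fun n : ℕ => (Measure.pi fun _ : Fin n => LL1) {y | e ≤ KS y}) atTop (𝓝 0) := by
  set η := min (1 / 4) (e / 8) with hη
  have hη0 : 0 < η := by positivity
  have hη1 : η ≤ 1 / 4 := min_le_left _ _
  have hη2 : η ≤ e / 8 := min_le_right _ _
  have hlim := ((tendsto_measure_not_close (δ := η ^ 2 / 8) (by positivity)).add
    tendsto_measure_exists_gt).add
    (tendsto_measure_integral_sq_gt (e := (η ^ 2 / 8) ^ 2) (by positivity))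
  simp only [add_zero] at hlim
  refine tendsto_of_tendsto_of_tendsto_of_le_of_le' tendsto_const_nhds hlim
    (Eventually.of_forall fun _ => zero_le) ?_
  filter_upwards [eventually_ge_atTop 1] with n hn
  refine le_trans (measure_mono_ae ?_) ((measure_union_le _ _).trans
    (add_le_add_left (measure_union_le _ _) _))
  filter_upwards [ae_sample_nonneg LL1 n LL1_Iio_zero] with y hy0 (hy : e ≤ KS y)
  by_contra hcon
  replace hcon : ¬ (((∃ t, 0 ≤ t ∧ η ^ 2 / 8 < |ecdf y t - L t|) ∨ ∃ i, (n : ℝ) ^ 2 < y i) ∨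
    (η ^ 2 / 8) ^ 2 < ∫ t in (0 : ℝ)..((n : ℝ) ^ 2), (ecdf y t - L t) ^ 2) := hcon
  push Not at hcon
  obtain ⟨⟨h1, h2⟩, h3⟩ := hcon
  have := KS_le_of_close hn hy0 hη0 hη1 h2 h1 h3
  linarith

/-- The critical values are eventually smaller than any positive number. -/
lemma eventually_lt_of_isCriticalValue {α : ℝ} (hα : 0 < α) {c : ℕ → ℝ}
    (hc : ∀ᶠ n in atTop, IsCriticalValue α n (c n)) {e : ℝ} (he : 0 < e) :
    ∀ᶠ n in atTop, c n < e := by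
  filter_upwards [hc, (tendsto_measure_le_KS he).eventually_lt_const (ENNReal.ofReal_pos.2 hα)]
    with n hn hlt
  by_contra! hcon
  exact (hn.2.trans (measure_mono fun y (hy : c n ≤ KS y) => hcon.trans hy)).not_gt hlt

lemma cdf_eq_zero_of_nonpos (ν : Measure ℝ) [IsProbabilityMeasure ν] (hac : ν ≪ volume)
    (hsupp : ν (Iio 0) = 0) {t : ℝ} (ht : t ≤ 0) : cdf ν t = 0 := by
  have h0 : ν (Iic 0) = 0 := by
    rw [← Iio_union_right]
    exact measure_union_null hsupp (hac (measure_singleton 0))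
  rw [cdf_eq_real, measureReal_def, measure_mono_null (Iic_subset_Iic.2 ht) h0,
    ENNReal.toReal_zero]

end IOR

/-! ### Consistency of the test -/

theorem theorem4
    (ν : Measure ℝ) [IsProbabilityMeasure ν]
    (hac : ν ≪ volume) (hsupp : ν (Iio 0) = 0)
    (hF : ¬ IOR.IsIOR (cdf ν))
    {Ω : Type*} [MeasurableSpace Ω] (P : Measure Ω) [IsProbabilityMeasure P]
    (X : ℕ → Ω → ℝ) (hX : ∀ i, Measurable (X i))
    (hlaw : ∀ i, P.map (X i) = ν) (hindep : iIndepFun X P)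
    (α : ℝ) (hα : 0 < α) (hα1 : α < 1)
    (c : ℕ → ℝ) (hc : ∀ᶠ n in atTop, IOR.IsCriticalValue α n (c n)) :
    Tendsto (fun n : ℕ => P {ω | c n < IOR.KS (fun i : Fin n => X i ω)})
      atTop (𝓝 1) := by
  obtain ⟨δ, hδ, T, hT⟩ := IOR.exists_le_KS_of_not_isIOR (monotone_cdf ν)
    (fun t ht => IOR.cdf_eq_zero_of_nonpos ν hac hsupp ht) hF
  have hlim : Tendsto (fun n : ℕ => 1 - (Measure.pi fun _ : Fin n => ν)
      {y | ∃ u ∈ T, δ ≤ |IOR.ecdf y u - cdf ν u|}) atTop (𝓝 1) := by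
    simpa using ENNReal.Tendsto.sub (tendsto_const_nhds (x := (1 : ENNReal)))
      (IOR.tendsto_measure_ecdf_far ν T hδ) (Or.inl ENNReal.one_ne_top)
  refine tendsto_of_tendsto_of_tendsto_of_le_of_le' hlim tendsto_const_nhds ?_
    (Eventually.of_forall fun _ => prob_le_one)
  filter_upwards [IOR.eventually_lt_of_isCriticalValue hα hc hδ, eventually_ge_atTop 1]
    with n hcn hn
  have hsample : Measurable fun ω => fun i : Fin n => X i ω :=
    measurable_pi_lambda _ fun i => hX i
  have hmap : P.map (fun ω => fun i : Fin n => X i ω) = Measure.pi fun _ : Fin n => ν := by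
    have h := (iIndepFun_iff_map_fun_eq_pi_map (f := fun i : Fin n => X i)
      fun i => (hX i).aemeasurable).1 (hindep.precomp Fin.val_injective)
    simpa only [hlaw] using h
  have hnn : ∀ᵐ ω ∂P, ∀ i : Fin n, 0 ≤ X i ω := by
    have h := IOR.ae_sample_nonneg ν n hsupp
    rw [← hmap] at h
    exact ae_of_ae_map hsample.aemeasurable h
  rw [tsub_le_iff_right]
  calc (1 : ENNReal) = P univ := measure_univ.symm
    _ ≤ P ({ω | c n < IOR.KS (fun i : Fin n => X i ω)} ∪ (fun ω => fun i : Fin n => X i ω) ⁻¹'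
          {y | ∃ u ∈ T, δ ≤ |IOR.ecdf y u - cdf ν u|}) := by
        refine measure_mono_ae ?_
        filter_upwards [hnn] with ω hω _
        by_cases hcl : ∃ u ∈ T, δ ≤ |IOR.ecdf (fun i : Fin n => X i ω) u - cdf ν u|
        · exact Or.inr hcl
        · push Not at hcl
          exact Or.inl (hcn.trans_le (hT n hn _ hω hcl))
    _ ≤ _ := (measure_union_le _ _).trans
        (add_le_add_right ((Measure.le_map_apply hsample.aemeasurable _).trans
          (by rw [hmap])) _)
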